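/- Let $G$ be a finite simple bipartite graph (properly 2-coloured) drawn in the plane without crossings, with an edge weight $\omega_e$ from a commutative ring on every edge $e$. For a weighted graph $H$ let $M(H)$ be the sum, over all perfect matchings $P$ of $H$, of $\prod_{e\in P}\omega_e$; subgraphs of $G$ inherit its weights, and $G-e$, $G-x$ denote deletion of an edge $e$, respectively of a vertex $x$ with all its incident edges. Let $e_1=a_1b_1$ and $e_2=a_2b_2$ be two independent edges (no common end) on the boundary of a face of $G$, and suppose that the vertices $a_1,b_1,a_2,b_2$ appear in this cyclic order on a face of $G$, that is, a closed topological disc can be inscribed in the face so that it touches $G$ exactly in these four vertices, and they occur in this cyclic order along the boundary of the disc. (In each case below $\omega_1=\omega_{e_1}$ and $\omega_2=\omega_{e_2}$.) (1) If $a_1$ and $a_2$ have the same colour, then $$M(G)\,M(G-e_1-e_2)=M(G-e_1)\,M(G-e_2)+\omega_1\omega_2\,M(G-a_1-b_2)\,M(G-a_2-b_1).$$ (2) If $a_1$ and $a_2$ have different colours, then $$M(G)\,M(G-e_1-e_2)=M(G-e_1)\,M(G-e_2)-\omega_1\omega_2\,M(G-a_1-a_2)\,M(G-b_1-b_2).$$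 -/

import Mathlib

/-- A plane drawing of the simple graph `G`, the plane being identified with `ℂ`: vertices are
distinct points, edges are (arbitrary continuous) simple arcs joining the two ends of the edge and
containing no other vertex, and two different edges have at most end vertices in common. -/
structure PlaneDrawing {V : Type*} (G : SimpleGraph V) where
  /-- the point representing a vertex -/
  pos : V → ℂ
  /-- the point set representing an edge (irrelevant on non-edges) -/
  arc : Sym2 V → Set ℂ
  pos_injective : Function.Injective pos
  arc_isArc : ∀ u v : V, G.Adj u v →
    ∃ γ : Path (pos u) (pos v), Function.Injective γ ∧ Set.range γ = arc s(u, v)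
  mem_of_pos_mem_arc : ∀ e ∈ G.edgeSet, ∀ v : V, pos v ∈ arc e → v ∈ e
  arc_inter_arc : ∀ e ∈ G.edgeSet, ∀ e' ∈ G.edgeSet, e ≠ e' → arc e ∩ arc e' ⊆ Set.range pos

namespace PlaneDrawing

variable {V : Type*} {G : SimpleGraph V}

/-- The set of all points of the plane that lie on the drawn graph. -/
def support (D : PlaneDrawing G) : Set ℂ :=
  Set.range D.pos ∪ ⋃ e ∈ G.edgeSet, D.arc e

/-- A face is a connected component of the complement of the drawn graph (the unbounded one
included). -/
def IsFace (D : PlaneDrawing G) (F : Set ℂ) : Prop :=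
  ∃ z ∈ D.supportᶜ, F = connectedComponentIn D.supportᶜ z

/-- The edge `e` lies on the boundary of the face `F`. -/
def EdgeOnBoundary (D : PlaneDrawing G) (F : Set ℂ) (e : Sym2 V) : Prop :=
  e ∈ G.edgeSet ∧ D.arc e ⊆ frontier F

/-- The vertices `p`, `q`, `r`, `s` appear in this cyclic order on the face `F`: a closed
topological disc can be inscribed in `F` so that it touches the drawn graph exactly at these four
vertices, which are met in the order `p`, `q`, `r`, `s` when one runs once along the boundary
circle of the disc. The disc is parametrized by the closed unit disc with the four vertices at
`1`, `i`, `-1`, `-i`; the parametrization may preserve or reverse the orientation. The boundary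
of `F` need not be a cycle, nor connected. -/
def CyclicOrderOnFace (D : PlaneDrawing G) (F : Set ℂ) (p q r s : V) : Prop :=
  D.IsFace F ∧
  ∃ φ : ℂ → ℂ,
    ContinuousOn φ (Metric.closedBall 0 1) ∧
    Set.InjOn φ (Metric.closedBall 0 1) ∧
    φ 1 = D.pos p ∧ φ Complex.I = D.pos q ∧ φ (-1) = D.pos r ∧ φ (-Complex.I) = D.pos s ∧
    ∀ z ∈ Metric.closedBall (0 : ℂ) 1,
      z ∉ ({1, Complex.I, -1, -Complex.I} : Set ℂ) → φ z ∈ F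

end PlaneDrawing

/-- `M(G)`: the sum over all perfect matchings `P` of the weighted graph `G` of the product of
the weights of the edges of `P`. -/
noncomputable def matchingSum {V R : Type*} [Finite V] [CommRing R]
    (G : SimpleGraph V) (w : Sym2 V → R) : R :=
  ∑ P ∈ (Set.toFinite {P : G.Subgraph | P.IsPerfectMatching}).toFinset,
    ∏ e ∈ (Set.toFinite P.edgeSet).toFinset, w e

/-- `M(G - A)` for a set `A` of vertices: the matching sum of the subgraph induced on the
complement of `A`, with the inherited weights. -/
noncomputable def matchingSumDelete {V R : Type*} [Finite V] [CommRing R]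
    (G : SimpleGraph V) (w : Sym2 V → R) (A : Set V) : R :=
  matchingSum (G.induce Aᶜ) (fun e => w (e.map Subtype.val))

/-!
Superimpose a matching of `G - S` on a matching of `G - S'`, where `S` and `S'` partition the four
terminals `p`, `q`, `r`, `s`. The component of `p` is an alternating path from `p` to another
terminal, and exchanging the two matchings along it moves its two ends between `S` and `S'`. If the
terminals lie in this order on a face, then no two disjoint connected subgraphs of `G` join `p` to
`r` and `q` to `s`: the corresponding paths in the plane, parametrized so that each of them starts
and ends with half a diameter of the inscribed disc, would have to cross, because the winding of
their difference around the boundary of a square is an odd multiple of `2 * π`. Hence the path ends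
at `q` or at `s`, and the exchange proves the condensation identity
`M(G) M(G-p-q-r-s) + M(G-q-s) M(G-p-r) = M(G-p-q) M(G-r-s) + M(G-p-s) M(G-q-r)`.
Expanding the matching sums along the two edges reduces the theorem to this identity for
`G - e₁ - e₂`, and the colouring kills one of its four products.
-/

section Winding

theorem existsUnique_continuous_log {A : Type*} [TopologicalSpace A] [SimplyConnectedSpace A]
    [LocallyPathConnectedSpace A] {f : A → ℂ} (hf : Continuous f) (hf₀ : ∀ a, f a ≠ 0) (a₀ : A)
    {z₀ : ℂ} (hz₀ : Complex.exp z₀ = f a₀) :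
    ∃! g : C(A, ℂ), g a₀ = z₀ ∧ ∀ a, Complex.exp (g a) = f a := by
  simpa only [funext_iff, Function.comp_apply, ContinuousMap.coe_mk] using
    Complex.isCoveringMapOn_exp.existsUnique_continuousMap_lifts (f := ⟨f, hf⟩) hz₀
      (fun a => by simpa using hf₀ a)

theorem exists_continuous_log {A : Type*} [TopologicalSpace A] [SimplyConnectedSpace A]
    [LocallyPathConnectedSpace A] {f : A → ℂ} (hf : Continuous f) (hf₀ : ∀ a, f a ≠ 0) :
    ∃ g : A → ℂ, Continuous g ∧ ∀ a, Complex.exp (g a) = f a := by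
  obtain ⟨a₀⟩ : Nonempty A := inferInstance
  obtain ⟨g, ⟨-, hg⟩, -⟩ := existsUnique_continuous_log hf hf₀ a₀ (Complex.exp_log (hf₀ a₀))
  exact ⟨g, g.continuous, hg⟩

theorem continuous_log_sub_eq {g g' : ℝ → ℂ} (hg : Continuous g) (hg' : Continuous g')
    (h : ∀ t, Complex.exp (g t) = Complex.exp (g' t)) (a b : ℝ) : g b - g a = g' b - g' a := by
  have hc : Continuous fun t => g' t + (g a - g' a) := by fun_prop
  have hexp : ∀ t, Complex.exp (g' t + (g a - g' a)) = Complex.exp (g t) := fun t => by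
    rw [Complex.exp_add, Complex.exp_sub, h a, div_self (Complex.exp_ne_zero _), mul_one, h t]
  have hunique := existsUnique_continuous_log (Complex.continuous_exp.comp hg)
    (fun t => Complex.exp_ne_zero _) a rfl
  have heq := hunique.unique (y₁ := ⟨g, hg⟩) (y₂ := ⟨_, hc⟩) ⟨rfl, fun _ => rfl⟩
    ⟨add_sub_cancel _ _, hexp⟩
  have hb : g b = g' b + (g a - g' a) := DFunLike.congr_fun heq b
  linear_combination hb

open Classical in
/-- The increment over `[-1, 1]` of a continuous logarithm of `f`, that is, the increment of
`log |f|` plus `I` times the angle swept by `f`; it is `0` if `f` has no continuous logarithm. -/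
noncomputable def logIncrement (f : ℝ → ℂ) : ℂ :=
  if h : ∃ g : ℝ → ℂ, Continuous g ∧ ∀ t, Complex.exp (g t) = f t
  then h.choose 1 - h.choose (-1) else 0

theorem logIncrement_eq {f g : ℝ → ℂ} (hg : Continuous g) (h : ∀ t, Complex.exp (g t) = f t) :
    logIncrement f = g 1 - g (-1) := by
  have hex : ∃ g : ℝ → ℂ, Continuous g ∧ ∀ t, Complex.exp (g t) = f t := ⟨g, hg, h⟩
  rw [logIncrement, dif_pos hex]
  exact continuous_log_sub_eq hex.choose_spec.1 hg
    (fun t => (hex.choose_spec.2 t).trans (h t).symm) _ _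

theorem exp_logIncrement {f : ℝ → ℂ} (hf : Continuous f) (hf₀ : ∀ t, f t ≠ 0) :
    Complex.exp (logIncrement f) = f 1 / f (-1) := by
  obtain ⟨g, hg, h⟩ := exists_continuous_log hf hf₀
  rw [logIncrement_eq hg h, Complex.exp_sub, h, h]

theorem logIncrement_neg_comp_neg {f : ℝ → ℂ} (hf : Continuous f) (hf₀ : ∀ t, f t ≠ 0) :
    logIncrement (fun t => -f (-t)) = -logIncrement f := by
  obtain ⟨g, hg, h⟩ := exists_continuous_log hf hf₀
  have hexp (t : ℝ) : Complex.exp (g (-t) + Real.pi * Complex.I) = -f (-t) := by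
    rw [Complex.exp_add, h, Complex.exp_pi_mul_I, mul_neg_one]
  rw [logIncrement_eq hg h, logIncrement_eq (by fun_prop) hexp, neg_neg]
  ring

/-- `2πI` times the winding number around `0` of the restriction of `H` to the boundary of the
square `[-1, 1] × [-1, 1]`. -/
noncomputable def boundaryWinding (H : ℝ → ℝ → ℂ) : ℂ :=
  logIncrement (fun s => H s (-1)) + logIncrement (fun t => H 1 t) -
    logIncrement (fun s => H s 1) - logIncrement (fun t => H (-1) t)

theorem boundaryWinding_eq_zero {H : ℝ → ℝ → ℂ} (hH : Continuous fun x : ℝ × ℝ => H x.1 x.2)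
    (hH₀ : ∀ s t, H s t ≠ 0) : boundaryWinding H = 0 := by
  obtain ⟨g, hg, h⟩ := exists_continuous_log hH fun x => hH₀ x.1 x.2
  rw [boundaryWinding,
    logIncrement_eq (g := fun s => g (s, -1)) (by fun_prop) fun s => h (s, -1),
    logIncrement_eq (g := fun t => g (1, t)) (by fun_prop) fun t => h (1, t),
    logIncrement_eq (g := fun s => g (s, 1)) (by fun_prop) fun s => h (s, 1),
    logIncrement_eq (g := fun t => g (-1, t)) (by fun_prop) fun t => h (-1, t)]
  ring

theorem boundaryWinding_sub_eq_zero {f g : ℝ → ℂ} (hf : Continuous f) (hg : Continuous g)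
    (hfg : ∀ s t, f s ≠ g t) : boundaryWinding (fun s t => f s - g t) = 0 :=
  boundaryWinding_eq_zero (by fun_prop) fun s t => sub_ne_zero.2 (hfg s t)

theorem boundaryWinding_eq_of_homotopy {K : ℝ → ℝ → ℝ → ℂ}
    (hK : Continuous fun x : ℝ × ℝ × ℝ => K x.1 x.2.1 x.2.2)
    (hK₀ : ∀ s t τ, |s| = 1 ∨ |t| = 1 → K s t τ ≠ 0) :
    boundaryWinding (fun s t => K s t (-1)) = boundaryWinding (fun s t => K s t 1) := by
  have bottom := boundaryWinding_eq_zero (H := fun s τ => K s (-1) τ)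
    (hK.comp (by fun_prop : Continuous fun x : ℝ × ℝ => (x.1, (-1 : ℝ), x.2)))
    fun s τ => hK₀ s (-1) τ (by simp)
  have top := boundaryWinding_eq_zero (H := fun s τ => K s 1 τ)
    (hK.comp (by fun_prop : Continuous fun x : ℝ × ℝ => (x.1, (1 : ℝ), x.2)))
    fun s τ => hK₀ s 1 τ (by simp)
  have left := boundaryWinding_eq_zero (H := fun t τ => K (-1) t τ)
    (hK.comp (by fun_prop : Continuous fun x : ℝ × ℝ => ((-1 : ℝ), x.1, x.2)))
    fun t τ => hK₀ (-1) t τ (by simp)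
  have right := boundaryWinding_eq_zero (H := fun t τ => K 1 t τ)
    (hK.comp (by fun_prop : Continuous fun x : ℝ × ℝ => ((1 : ℝ), x.1, x.2)))
    fun t τ => hK₀ 1 t τ (by simp)
  simp only [boundaryWinding] at bottom top left right ⊢
  linear_combination bottom + right - top - left

theorem boundaryWinding_ne_zero_of_odd {H : ℝ → ℝ → ℂ}
    (hH : Continuous fun x : ℝ × ℝ => H x.1 x.2) (hH₀ : ∀ s t, |s| = 1 ∨ |t| = 1 → H s t ≠ 0)
    (hodd : ∀ s t, H (-s) (-t) = -H s t) : boundaryWinding H ≠ 0 := by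
  have hbot : Continuous fun s => H s (-1) := hH.comp (.prodMk_left (-1))
  have hright : Continuous fun t => H 1 t := hH.comp (.prodMk_right 1)
  have hbot₀ (s : ℝ) : H s (-1) ≠ 0 := hH₀ s (-1) (by simp)
  have hright₀ (t : ℝ) : H 1 t ≠ 0 := hH₀ 1 t (by simp)
  have htop : logIncrement (fun s => H s 1) = -logIncrement (fun s => H s (-1)) := by
    simpa only [hodd, neg_neg] using logIncrement_neg_comp_neg hbot hbot₀
  have hleft : logIncrement (fun t => H (-1) t) = -logIncrement (fun t => H 1 t) := by
    simpa only [← hodd, neg_neg] using logIncrement_neg_comp_neg hright hright₀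
  intro h
  have hhalf : logIncrement (fun s => H s (-1)) + logIncrement (fun t => H 1 t) = 0 := by
    rw [boundaryWinding, htop, hleft] at h
    linear_combination h / 2
  have hone : H 1 1 / H (-1) (-1) = 1 := by
    rw [← Complex.exp_zero, ← hhalf, Complex.exp_add, exp_logIncrement hbot hbot₀,
      exp_logIncrement hright hright₀, mul_comm, div_mul_div_cancel₀ (hright₀ (-1))]
  rw [hodd, div_neg, div_self (hright₀ 1)] at hone
  norm_num at hone

theorem boundaryWinding_sub_exchange {P Q U V : ℝ → ℂ} (hP : P (-1) = U (-1)) (hP' : P 1 = U 1)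
    (hQ : Q (-1) = V (-1)) (hQ' : Q 1 = V 1) :
    boundaryWinding (fun s t => U s - V t) + boundaryWinding (fun s t => P s - Q t) =
      boundaryWinding (fun s t => U s - Q t) + boundaryWinding (fun s t => P s - V t) := by
  simp only [boundaryWinding, hP, hP', hQ, hQ']
  ring

end Winding

section DiscDiameters

/-- The retraction of the real line onto `[-1, 1]`. -/
noncomputable def clamp (x : ℝ) : ℝ := max (-1) (min 1 x)

theorem continuous_clamp : Continuous clamp := by unfold clamp; fun_prop

theorem clamp_neg (x : ℝ) : clamp (-x) = -clamp x := by unfold clamp; grind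

theorem abs_clamp_le (x : ℝ) : |clamp x| ≤ 1 := by unfold clamp; grind

@[simp] theorem clamp_one : clamp 1 = 1 := by norm_num [clamp]

@[simp] theorem clamp_neg_one : clamp (-1) = -1 := by norm_num [clamp]

theorem clamp_ne_zero {x : ℝ} (hx : |x| = 1) : clamp x ≠ 0 := by
  rcases eq_or_eq_neg_of_abs_eq hx with rfl | rfl <;> simp

theorem clamp_mem_closedBall (x : ℝ) : (clamp x : ℂ) ∈ Metric.closedBall (0 : ℂ) 1 := by
  simpa using abs_clamp_le x

theorem clamp_mul_I_mem_closedBall (y : ℝ) :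
    (clamp y * Complex.I : ℂ) ∈ Metric.closedBall (0 : ℂ) 1 := by
  simpa using abs_clamp_le y

/-- The difference of the values of `φ` at the ends of a segment, which is the one from `v` to `u`
for `α = 1` and is translated to be centred at `0` as `α` decreases to `1 / 2`. -/
noncomputable def slidingDifference (φ : ℂ → ℂ) (u v : ℂ) (α : ℝ) : ℂ :=
  φ (α • u + (1 - α) • -v) - φ (α • v + (1 - α) • -u)

theorem slidingDifference_one (φ : ℂ → ℂ) (u v : ℂ) : slidingDifference φ u v 1 = φ u - φ v := by
  simp [slidingDifference]

theorem slidingDifference_neg_half (φ : ℂ → ℂ) (u v : ℂ) :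
    slidingDifference φ (-u) (-v) (1 / 2) = -slidingDifference φ u v (1 / 2) := by
  rw [slidingDifference, slidingDifference, neg_sub]
  congr 2 <;> module

theorem combo_mem_closedBall {u v : ℂ} {α : ℝ} (hu : u ∈ Metric.closedBall (0 : ℂ) 1)
    (hv : v ∈ Metric.closedBall (0 : ℂ) 1) (hα : α ∈ Set.Icc 0 1) :
    α • u + (1 - α) • -v ∈ Metric.closedBall (0 : ℂ) 1 :=
  convex_closedBall (0 : ℂ) 1 hu (by simpa using hv) hα.1 (sub_nonneg.2 hα.2) (add_sub_cancel _ _)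

theorem slidingDifference_ne_zero {φ : ℂ → ℂ} (hφ : Set.InjOn φ (Metric.closedBall 0 1))
    {u v : ℂ} {α : ℝ} (hu : u ∈ Metric.closedBall (0 : ℂ) 1)
    (hv : v ∈ Metric.closedBall (0 : ℂ) 1) (hα : α ∈ Set.Icc 0 1) (huv : u ≠ v) :
    slidingDifference φ u v α ≠ 0 := by
  intro h
  have heq := hφ (combo_mem_closedBall hu hv hα) (combo_mem_closedBall hv hu hα) (sub_eq_zero.1 h)
  apply huv
  simp only [Complex.real_smul, Complex.ofReal_sub, Complex.ofReal_one] at heq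
  linear_combination heq

theorem continuous_slidingDifference {X : Type*} [TopologicalSpace X] {φ : ℂ → ℂ}
    (hφ : ContinuousOn φ (Metric.closedBall 0 1)) {u v : X → ℂ} {α : X → ℝ}
    (hu : Continuous u) (hv : Continuous v) (hα : Continuous α)
    (hu₁ : ∀ x, u x ∈ Metric.closedBall (0 : ℂ) 1) (hv₁ : ∀ x, v x ∈ Metric.closedBall (0 : ℂ) 1)
    (hα₁ : ∀ x, α x ∈ Set.Icc 0 1) :
    Continuous fun x => slidingDifference φ (u x) (v x) (α x) :=
  (hφ.comp_continuous (by fun_prop) fun x => combo_mem_closedBall (hu₁ x) (hv₁ x) (hα₁ x)).sub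
    (hφ.comp_continuous (by fun_prop) fun x => combo_mem_closedBall (hv₁ x) (hu₁ x) (hα₁ x))

theorem clamp_ne_clamp_mul_I {s t : ℝ} (h : |s| = 1 ∨ |t| = 1) :
    (clamp s : ℂ) ≠ clamp t * Complex.I := by
  intro heq
  have hre : clamp s = 0 := by simpa using congrArg Complex.re heq
  have him : clamp t = 0 := by simpa using (congrArg Complex.im heq).symm
  exact h.elim (fun hs => clamp_ne_zero hs hre) (fun ht => clamp_ne_zero ht him)

/-- Sliding the segments between the two diameters to the centre of the disc is a homotopy to an
odd map. -/
theorem boundaryWinding_diameters_ne_zero {φ : ℂ → ℂ}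
    (hφ : ContinuousOn φ (Metric.closedBall 0 1)) (hφi : Set.InjOn φ (Metric.closedBall 0 1)) :
    boundaryWinding (fun s t => φ (clamp s) - φ (clamp t * Complex.I)) ≠ 0 := by
  let K (s t τ : ℝ) : ℂ := slidingDifference φ (clamp s) (clamp t * Complex.I) ((3 + clamp τ) / 4)
  have hα (τ : ℝ) : (3 + clamp τ) / 4 ∈ Set.Icc 0 1 := by
    have := abs_le.1 (abs_clamp_le τ)
    constructor <;> linarith
  have hclamp := continuous_clamp
  have hK : Continuous fun x : ℝ × ℝ × ℝ => K x.1 x.2.1 x.2.2 :=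
    continuous_slidingDifference hφ (by fun_prop) (by fun_prop) (by fun_prop)
      (fun x => clamp_mem_closedBall x.1) (fun x => clamp_mul_I_mem_closedBall x.2.1)
      fun x => hα x.2.2
  have hK₀ (s t τ : ℝ) (h : |s| = 1 ∨ |t| = 1) : K s t τ ≠ 0 :=
    slidingDifference_ne_zero hφi (clamp_mem_closedBall s) (clamp_mul_I_mem_closedBall t) (hα τ)
      (clamp_ne_clamp_mul_I h)
  have hone (s t : ℝ) : K s t 1 = φ (clamp s) - φ (clamp t * Complex.I) := by
    norm_num [K, slidingDifference_one]
  have hodd (s t : ℝ) : K (-s) (-t) (-1) = -K s t (-1) := by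
    have hhalf : ((3 : ℝ) + clamp (-1)) / 4 = 1 / 2 := by norm_num
    simp only [K, hhalf, clamp_neg s, clamp_neg t, Complex.ofReal_neg, neg_mul,
      slidingDifference_neg_half]
  simp only [← hone]
  rw [← boundaryWinding_eq_of_homotopy hK hK₀]
  exact boundaryWinding_ne_zero_of_odd
    (hK.comp (by fun_prop : Continuous fun x : ℝ × ℝ => (x.1, x.2, (-1 : ℝ))))
    (fun s t => hK₀ s t (-1)) hodd

/-- Two paths that join the ends of the two diameters outside the disc cross: otherwise replacing
the diameters by the paths one at a time would show that their differences have winding number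
zero. -/
theorem exists_eq_of_paths_outside_disc {φ : ℂ → ℂ}
    (hφ : ContinuousOn φ (Metric.closedBall 0 1)) (hφi : Set.InjOn φ (Metric.closedBall 0 1))
    (P : Path (φ (-1)) (φ 1)) (Q : Path (φ (-Complex.I)) (φ Complex.I))
    (hP : ∀ s, ∀ z ∈ Metric.closedBall (0 : ℂ) 1, φ z = P s → z = 1 ∨ z = -1)
    (hQ : ∀ t, ∀ z ∈ Metric.closedBall (0 : ℂ) 1, φ z = Q t → z = Complex.I ∨ z = -Complex.I) :
    ∃ s t, P s = Q t := by
  by_contra! hPQ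
  have hclamp := continuous_clamp
  have hU : Continuous fun s => φ (clamp s) :=
    hφ.comp_continuous (by fun_prop) clamp_mem_closedBall
  have hV : Continuous fun t => φ (clamp t * Complex.I) :=
    hφ.comp_continuous (by fun_prop) clamp_mul_I_mem_closedBall
  have hPc : Continuous fun s : ℝ => P.extend ((1 + s) / 2) :=
    P.continuous_extend.comp (by fun_prop)
  have hQc : Continuous fun t : ℝ => Q.extend ((1 + t) / 2) :=
    Q.continuous_extend.comp (by fun_prop)
  have hPQ₀ := boundaryWinding_sub_eq_zero hPc hQc fun s t => hPQ _ _
  have hPV₀ := boundaryWinding_sub_eq_zero hPc hV fun s t h => by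
    rcases hP _ _ (clamp_mul_I_mem_closedBall t) h.symm with h | h <;>
      simpa using congrArg Complex.re h
  have hUQ₀ := boundaryWinding_sub_eq_zero hU hQc fun s t h => by
    rcases hQ _ _ (clamp_mem_closedBall s) h with h | h <;> simpa using congrArg Complex.im h
  have hexchange := boundaryWinding_sub_exchange (P := fun s => P.extend ((1 + s) / 2))
    (U := fun s => φ (clamp s)) (Q := fun t => Q.extend ((1 + t) / 2))
    (V := fun t => φ (clamp t * Complex.I)) (by simp) (by simp) (by simp) (by simp)
  refine boundaryWinding_diameters_ne_zero hφ hφi ?_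
  rwa [hPQ₀, hPV₀, hUQ₀, add_zero, add_zero] at hexchange

end DiscDiameters

/-- Disjoint connected subgraphs of `G` do not join `p` to `r` and `q` to `s`, that is, `G` has no
cross on the cyclic sequence `p`, `q`, `r`, `s`. The two subgraphs are encoded as components of one
subgraph `H`. -/
def IsCrossless {V : Type*} (G : SimpleGraph V) (p q r s : V) : Prop :=
  ∀ H ≤ G, H.Reachable p r → H.Reachable q s → H.Reachable p q

theorem IsCrossless.mono {V : Type*} {G G' : SimpleGraph V} {p q r s : V}
    (h : IsCrossless G p q r s) (hG : G' ≤ G) : IsCrossless G' p q r s :=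
  fun H hH => h H (hH.trans hG)

namespace PlaneDrawing

variable {V : Type*} {G H : SimpleGraph V} {D : PlaneDrawing G}

/-- The part of a drawing that represents the connected component of `v` in a subgraph `H`. -/
def componentSupport (D : PlaneDrawing G) (H : SimpleGraph V) (v : V) : Set ℂ :=
  {x | ∃ u, H.Reachable v u ∧ (x = D.pos u ∨ ∃ u', H.Adj u u' ∧ x ∈ D.arc s(u, u'))}

theorem componentSupport_subset_support (hH : H ≤ G) (v : V) :
    D.componentSupport H v ⊆ D.support := by
  rintro x ⟨u, -, rfl | ⟨u', huu', hx⟩⟩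
  · exact Or.inl ⟨u, rfl⟩
  · exact Or.inr (Set.mem_biUnion (x := s(u, u')) (hH huu') hx)

theorem joinedIn_componentSupport (hH : H ≤ G) {v u : V} (h : H.Reachable v u) :
    JoinedIn (D.componentSupport H v) (D.pos v) (D.pos u) := by
  rw [SimpleGraph.reachable_eq_reflTransGen] at h
  induction h with
  | refl => exact .refl ⟨v, .rfl, Or.inl rfl⟩
  | @tail u u' hvu huu' ih =>
    rw [← SimpleGraph.reachable_eq_reflTransGen] at hvu
    obtain ⟨γ, -, hγ⟩ := D.arc_isArc _ _ (hH huu')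
    exact ih.trans ⟨γ, fun t => ⟨u, hvu, Or.inr ⟨u', huu', hγ ▸ Set.mem_range_self t⟩⟩⟩

theorem reachable_of_pos_mem_componentSupport (hH : H ≤ G) {v u : V}
    (h : D.pos u ∈ D.componentSupport H v) : H.Reachable v u := by
  obtain ⟨x, hvx, h | ⟨y, hxy, h⟩⟩ := h
  · rwa [D.pos_injective h]
  · rcases Sym2.mem_iff.1 (D.mem_of_pos_mem_arc _ (hH hxy) u h) with rfl | rfl
    · exact hvx
    · exact hvx.trans hxy.reachable

theorem reachable_of_mem_componentSupport (hH : H ≤ G) {v v' : V} {x : ℂ}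
    (h : x ∈ D.componentSupport H v) (h' : x ∈ D.componentSupport H v') : H.Reachable v v' := by
  by_cases hx : x ∈ Set.range D.pos
  · obtain ⟨u, rfl⟩ := hx
    exact (reachable_of_pos_mem_componentSupport hH h).trans
      (reachable_of_pos_mem_componentSupport hH h').symm
  obtain ⟨u, hvu, rfl | ⟨y, huy, hxy⟩⟩ := h
  · exact absurd ⟨u, rfl⟩ hx
  obtain ⟨u', hvu', rfl | ⟨y', huy', hxy'⟩⟩ := h'
  · exact absurd ⟨u', rfl⟩ hx
  have he : s(u, y) = s(u', y') := by
    by_contra he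
    exact hx (D.arc_inter_arc _ (hH huy) _ (hH huy') he ⟨hxy, hxy'⟩)
  rcases Sym2.mem_iff.1 (he ▸ Sym2.mem_mk_left u' y' : u' ∈ s(u, y)) with rfl | rfl
  · exact hvu.trans hvu'.symm
  · exact (hvu.trans huy.reachable).trans hvu'.symm

/-- Two paths in the drawing that join opposite vertices leave the inscribed disc only at the ends
of perpendicular diameters, so they meet. -/
theorem CyclicOrderOnFace.isCrossless {F : Set ℂ} {p q r s : V}
    (h : D.CyclicOrderOnFace F p q r s) : IsCrossless G p q r s := by
  intro H hH hpr hqs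
  by_contra hpq
  obtain ⟨⟨x, -, rfl⟩, φ, hφ, hφi, hφp, hφq, hφr, hφs, hF⟩ := h
  obtain ⟨P, hP⟩ := joinedIn_componentSupport (D := D) hH hpr.symm
  obtain ⟨Q, hQ⟩ := joinedIn_componentSupport (D := D) hH hqs.symm
  have hcorner {v : V} {z : ℂ} (hz : z ∈ Metric.closedBall (0 : ℂ) 1)
      (hv : φ z ∈ D.componentSupport H v) : z ∈ ({1, Complex.I, -1, -Complex.I} : Set ℂ) := by
    by_contra hz'
    exact connectedComponentIn_subset _ _ (hF z hz hz') (componentSupport_subset_support hH v hv)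
  have hreach {v u : V} {z : ℂ} (hz : φ z = D.pos u) (hv : φ z ∈ D.componentSupport H v) :
      H.Reachable v u := reachable_of_pos_mem_componentSupport hH (hz ▸ hv)
  obtain ⟨t, t', htt'⟩ := exists_eq_of_paths_outside_disc hφ hφi (P.cast hφr hφp) (Q.cast hφs hφq)
    (fun t z hz hzP => by
      have hzr : φ z ∈ D.componentSupport H r := hzP ▸ hP t
      rcases hcorner hz hzr with rfl | rfl | rfl | rfl
      · exact Or.inl rfl
      · exact absurd (hpr.trans (hreach hφq hzr)) hpq
      · exact Or.inr rfl
      · exact absurd ((hpr.trans (hreach hφs hzr)).trans hqs.symm) hpq)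
    (fun t z hz hzQ => by
      have hzs : φ z ∈ D.componentSupport H s := hzQ ▸ hQ t
      rcases hcorner hz hzs with rfl | rfl | rfl | rfl
      · exact absurd (hqs.trans (hreach hφp hzs)).symm hpq
      · exact Or.inl rfl
      · exact absurd ((hqs.trans (hreach hφr hzs)).trans hpr.symm).symm hpq
      · exact Or.inr rfl)
  have hmeet : P t ∈ D.componentSupport H s := (show P t = Q t' from htt') ▸ hQ t'
  have hrs : H.Reachable r s := reachable_of_mem_componentSupport hH (hP t) hmeet
  exact hpq ((hpr.trans hrs).trans hqs.symm)

end PlaneDrawing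

section Matchings

variable {V R : Type*} {G : SimpleGraph V} {S : Set V} {A : Finset (Sym2 V)}

/-- `A` is the edge set of a perfect matching of the graph `G - S`. Working with sets of edges of
`G` makes the matchings of `G - S` for various `S` objects of the same type. -/
structure IsMatchingOff (G : SimpleGraph V) (S : Set V) (A : Finset (Sym2 V)) : Prop where
  subset_edgeSet : (A : Set (Sym2 V)) ⊆ G.edgeSet
  eq_of_mem_of_mem : ∀ e ∈ A, ∀ e' ∈ A, ∀ v ∈ e, v ∈ e' → e = e'
  exists_mem_iff : ∀ v, (∃ e ∈ A, v ∈ e) ↔ v ∉ S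

theorem IsMatchingOff.notMem (hA : IsMatchingOff G S A) {e : Sym2 V} (he : e ∈ A) {v : V}
    (hv : v ∈ e) : v ∉ S :=
  (hA.exists_mem_iff v).1 ⟨e, he, hv⟩

theorem IsMatchingOff.not_isDiag (hA : IsMatchingOff G S A) {e : Sym2 V} (he : e ∈ A) :
    ¬ e.IsDiag :=
  G.not_isDiag_of_mem_edgeSet (hA.subset_edgeSet he)

theorem isPerfectMatching_iff_isMatchingOff [Finite V] (P : G.Subgraph) :
    P.IsPerfectMatching ↔ IsMatchingOff G ∅ (Set.toFinite P.edgeSet).toFinset := by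
  rw [SimpleGraph.Subgraph.isPerfectMatching_iff]
  constructor
  · refine fun hP => ⟨by simpa using P.edgeSet_subset, fun e he e' he' v hv hv' => ?_, fun v => ?_⟩
    · obtain ⟨u, rfl⟩ := Sym2.mem_iff_exists.1 hv
      obtain ⟨u', rfl⟩ := Sym2.mem_iff_exists.1 hv'
      rw [(hP v).unique (y₁ := u) (y₂ := u') (by simpa using he) (by simpa using he')]
    · obtain ⟨u, hu, -⟩ := hP v
      simpa using ⟨s(v, u), hu, Sym2.mem_mk_left v u⟩
  · intro hP v
    obtain ⟨e, he, hv⟩ := (hP.exists_mem_iff v).2 (Set.notMem_empty v)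
    obtain ⟨u, rfl⟩ := Sym2.mem_iff_exists.1 hv
    refine ⟨u, by simpa using he, fun u' hu' => ?_⟩
    exact Sym2.congr_right.1 (hP.eq_of_mem_of_mem s(v, u') (by simpa using hu') s(v, u) he v
      (Sym2.mem_mk_left v u') (Sym2.mem_mk_left v u))

theorem isMatchingOff_map_iff {W : Type*} {H : SimpleGraph W} (f : H ↪g G)
    (hf : Set.range f = Sᶜ) {B : Finset (Sym2 W)} :
    IsMatchingOff G S (B.map f.toEmbedding.sym2Map) ↔ IsMatchingOff H ∅ B := by
  have hmem (v : W) (e : Sym2 W) : f v ∈ e.map f ↔ v ∈ e := by simp [Sym2.mem_map]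
  have hrange {e : Sym2 W} {u : V} (hu : u ∈ e.map f) : u ∈ Set.range f :=
    (Sym2.mem_map.1 hu).imp fun _ => And.right
  have hf' (v : W) : f v ∉ S := Set.mem_compl_iff _ _ |>.1 (hf ▸ Set.mem_range_self v)
  have hinj : Function.Injective (Sym2.map f) := Sym2.map.injective f.injective
  constructor
  · refine fun h => ⟨fun e he => ?_, fun e he e' he' v hv hv' => ?_, fun v => ?_⟩
    · exact f.map_mem_edgeSet_iff.1 (h.subset_edgeSet (Finset.mem_map_of_mem _ he))
    · exact hinj (h.eq_of_mem_of_mem _ (Finset.mem_map_of_mem _ he) _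
        (Finset.mem_map_of_mem _ he') (f v) ((hmem v e).2 hv) ((hmem v e').2 hv'))
    · simpa [hmem, hf' v] using h.exists_mem_iff (f v)
  · refine fun h => ⟨?_, ?_, fun u => ⟨?_, fun hu => ?_⟩⟩
    · simpa [Set.subset_def, f.map_mem_edgeSet_iff] using h.subset_edgeSet
    · simp only [Finset.forall_mem_map]
      intro e he e' he' u hu hu'
      obtain ⟨v, rfl⟩ := hrange hu
      rw [h.eq_of_mem_of_mem e he e' he' v ((hmem v e).1 hu) ((hmem v e').1 hu')]
    · simp only [Finset.mem_map]
      rintro ⟨-, ⟨e, -, rfl⟩, hu⟩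
      exact Set.mem_compl_iff _ _ |>.1 (hf ▸ hrange hu)
    · obtain ⟨v, rfl⟩ : u ∈ Set.range f := hf ▸ hu
      obtain ⟨e, he, hv⟩ := (h.exists_mem_iff v).2 (Set.notMem_empty v)
      exact ⟨_, Finset.mem_map_of_mem _ he, (hmem v e).2 hv⟩

theorem IsMatchingOff.exists_map_eq {W : Type*} {H : SimpleGraph W} (f : H ↪g G)
    (hf : Set.range f = Sᶜ) (hA : IsMatchingOff G S A) :
    ∃ B : Finset (Sym2 W), B.map f.toEmbedding.sym2Map = A := by
  classical
  have hrange {e : Sym2 V} (he : e ∈ A) {v : V} (hv : v ∈ e) : v ∈ Set.range f :=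
    hf ▸ hA.notMem he hv
  have hsub : (A : Set (Sym2 V)) ⊆ f.toEmbedding.sym2Map '' Set.univ := by
    rintro ⟨u, v⟩ he
    obtain ⟨x, rfl⟩ := hrange he (Sym2.mem_mk_left _ _)
    obtain ⟨y, rfl⟩ := hrange he (Sym2.mem_mk_right _ _)
    exact ⟨s(x, y), trivial, rfl⟩
  obtain ⟨B, -, rfl⟩ := Finset.subset_set_image_iff.1 hsub
  exact ⟨B, Finset.map_eq_image _ _⟩

variable [Finite V]

/-- The edge sets of the perfect matchings of `G - S`. -/
noncomputable def matchings (G : SimpleGraph V) (S : Set V) : Finset (Finset (Sym2 V)) :=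
  (Set.toFinite {A | IsMatchingOff G S A}).toFinset

@[simp] theorem mem_matchings : A ∈ matchings G S ↔ IsMatchingOff G S A := by
  simp [matchings]

theorem matchingSum_eq_sum [CommRing R] (G : SimpleGraph V) (w : Sym2 V → R) :
    matchingSum G w = ∑ A ∈ matchings G ∅, ∏ e ∈ A, w e := by
  refine Finset.sum_nbij (fun P => (Set.toFinite P.edgeSet).toFinset) ?_ ?_ ?_ fun _ _ => rfl
  · simp [isPerfectMatching_iff_isMatchingOff]
  · intro P hP P' hP' h
    simp only [Set.Finite.coe_toFinset, Set.mem_ofPred_eq] at hP hP'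
    exact SimpleGraph.Subgraph.IsMatching.injOn_edgeSet hP.1 hP'.1 (by simpa using h)
  · intro A hA
    rw [Finset.mem_coe, mem_matchings] at hA
    let P : G.Subgraph :=
      { verts := Set.univ
        Adj u v := s(u, v) ∈ A
        adj_sub huv := hA.subset_edgeSet huv
        edge_vert _ := Set.mem_univ _
        symm := ⟨fun _ _ h => Sym2.eq_swap ▸ h⟩ }
    have hPA : (Set.toFinite P.edgeSet).toFinset = A := by
      ext ⟨u, v⟩
      simp [P]
    exact ⟨P, by simpa [isPerfectMatching_iff_isMatchingOff, hPA], hPA⟩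

theorem matchingSumDelete_eq_sum [CommRing R] (G : SimpleGraph V) (w : Sym2 V → R) (S : Set V) :
    matchingSumDelete G w S = ∑ A ∈ matchings G S, ∏ e ∈ A, w e := by
  let f := SimpleGraph.Embedding.induce (G := G) Sᶜ
  have hf : Set.range f = Sᶜ := Subtype.range_coe
  rw [matchingSumDelete, matchingSum_eq_sum]
  refine Finset.sum_nbij (Finset.map f.toEmbedding.sym2Map) ?_
    (Finset.map_injective _).injOn ?_ ?_
  · simp [isMatchingOff_map_iff f hf]
  · intro A hA
    rw [Finset.mem_coe, mem_matchings] at hA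
    obtain ⟨B, rfl⟩ := hA.exists_map_eq f hf
    exact ⟨B, by simpa [isMatchingOff_map_iff f hf] using hA, rfl⟩
  · intro B _
    rw [Finset.prod_map]
    rfl

end Matchings

section Superposition

variable {V : Type*} {G : SimpleGraph V} {S S' K : Set V} {A B : Finset (Sym2 V)} {e : Sym2 V}
  {p v : V}

/-- The graph whose edges are those of `A` and those of `B`. -/
def superposition (A B : Finset (Sym2 V)) : SimpleGraph V :=
  SimpleGraph.fromEdgeSet (A ∪ B)

/-- The vertices of the component of `p` in the superposition of `A` and `B`. -/
def superpositionComponent (A B : Finset (Sym2 V)) (p : V) : Set V :=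
  ((superposition A B).connectedComponentMk p).supp

theorem superposition_comm (A B : Finset (Sym2 V)) : superposition A B = superposition B A := by
  rw [superposition, superposition, Set.union_comm]

theorem superpositionComponent_comm (A B : Finset (Sym2 V)) (p : V) :
    superpositionComponent A B p = superpositionComponent B A p := by
  rw [superpositionComponent, superposition_comm, superpositionComponent]

theorem superposition_le (hA : IsMatchingOff G S A) (hB : IsMatchingOff G S' B) :
    superposition A B ≤ G := by
  rw [superposition, SimpleGraph.fromEdgeSet_le]
  exact Set.sdiff_subset.trans (Set.union_subset hA.subset_edgeSet hB.subset_edgeSet)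

theorem mem_superpositionComponent :
    v ∈ superpositionComponent A B p ↔ (superposition A B).Reachable p v := by
  rw [superpositionComponent, SimpleGraph.ConnectedComponent.mem_supp_iff,
    SimpleGraph.ConnectedComponent.eq, SimpleGraph.reachable_comm]

theorem mem_sym2_superpositionComponent_left (he : e ∈ A) (hv : v ∈ e)
    (hvK : v ∈ superpositionComponent A B p) : e ∈ (superpositionComponent A B p).sym2 := by
  obtain ⟨u, rfl⟩ := Sym2.mem_iff_exists.1 hv
  refine Set.mk_mem_sym2_iff.2 ⟨hvK, ?_⟩
  rcases eq_or_ne v u with rfl | huv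
  · exact hvK
  have hadj : (superposition A B).Adj v u :=
    (SimpleGraph.fromEdgeSet_adj _).2 ⟨Or.inl he, huv⟩
  exact (SimpleGraph.ConnectedComponent.mem_supp_congr_adj _ hadj).1 hvK

theorem mem_sym2_superpositionComponent_right (he : e ∈ B) (hv : v ∈ e)
    (hvK : v ∈ superpositionComponent A B p) : e ∈ (superpositionComponent A B p).sym2 := by
  rw [superpositionComponent_comm] at hvK ⊢
  exact mem_sym2_superpositionComponent_left he hv hvK

theorem IsMatchingOff.ncard_diff [Finite V] (hA : IsMatchingOff G S A) (U : Set V) :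
    (U \ S).ncard = ∑ e ∈ A, {v ∈ U | v ∈ e}.ncard := by
  have hU : U \ S = ⋃ e ∈ (A : Set (Sym2 V)), {v ∈ U | v ∈ e} := by
    ext v
    simp [← hA.exists_mem_iff v]
  have hdisj : (A : Set (Sym2 V)).PairwiseDisjoint fun e => {v ∈ U | v ∈ e} := by
    refine fun e he e' he' hne => Set.disjoint_left.2 fun v hv hv' => hne ?_
    exact hA.eq_of_mem_of_mem e he e' he' v hv.2 hv'.2
  rw [hU, A.finite_toSet.ncard_biUnion (fun _ _ => Set.toFinite _) hdisj, finsum_mem_coe_finset]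

open Classical in
theorem IsMatchingOff.ncard_diff_eq_two_mul [Finite V] (hA : IsMatchingOff G S A)
    (hK : ∀ e ∈ A, ∀ v ∈ e, v ∈ K → e ∈ K.sym2) :
    (K \ S).ncard = 2 * {e ∈ A | e ∈ K.sym2}.card := by
  have hedge : ∀ e ∈ A, {v ∈ K | v ∈ e}.ncard = if e ∈ K.sym2 then 2 else 0 := by
    intro e he
    split_ifs with heK
    · rw [← e.card_toFinset_of_not_isDiag (hA.not_isDiag he), ← Set.ncard_coe_finset]
      congr 1
      ext v
      simpa using fun hv => Set.mem_sym2_iff_subset.1 heK hv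
    · rw [Set.ncard_eq_zero]
      exact Set.eq_empty_of_forall_notMem fun v hv => heK (hK e he v hv.2 hv.1)
  rw [hA.ncard_diff, Finset.sum_congr rfl hedge, ← Finset.sum_filter, Finset.sum_const,
    smul_eq_mul, mul_comm]

open Classical in
theorem ncard_superpositionComponent_le (A B : Finset (Sym2 V)) (p : V) :
    (superpositionComponent A B p).ncard ≤
      {e ∈ A | e ∈ (superpositionComponent A B p).sym2}.card +
        {e ∈ B | e ∈ (superpositionComponent A B p).sym2}.card + 1 := by
  set K := superpositionComponent A B p
  let H := (superposition A B).induce K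
  have hconn : H.Connected :=
    ((superposition A B).connectedComponentMk p).connected_toSimpleGraph
  have hedges : Sym2.map Subtype.val '' H.edgeSet ⊆
      ({e ∈ A | e ∈ K.sym2} ∪ {e ∈ B | e ∈ K.sym2} : Finset (Sym2 V)) := by
    rintro _ ⟨⟨u, v⟩, huv, rfl⟩
    have hadj : s(u.1, v.1) ∈ A ∨ s(u.1, v.1) ∈ B := ((SimpleGraph.fromEdgeSet_adj _).1 huv).1
    simpa [u.2, v.2] using hadj
  calc K.ncard ≤ H.edgeSet.ncard + 1 := hconn.card_vert_le_card_edgeSet_add_one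
    _ = (Sym2.map Subtype.val '' H.edgeSet).ncard + 1 := by
      rw [Set.ncard_image_of_injective _ (Sym2.map.injective Subtype.val_injective)]
    _ ≤ ({e ∈ A | e ∈ K.sym2} ∪ {e ∈ B | e ∈ K.sym2}).card + 1 := by
      rw [← Set.ncard_coe_finset]
      gcongr
      exact Finset.finite_toSet _
    _ ≤ _ := by
      gcongr
      exact Finset.card_union_le _ _

/-- The component is a path or a cycle whose edges alternate between `A` and `B`. It meets `S ∪ S'`
exactly in the ends of the path. -/
theorem ncard_superpositionComponent_inter [Finite V] (hA : IsMatchingOff G S A)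
    (hB : IsMatchingOff G S' B) (hS : Disjoint S S') (hp : p ∈ S ∪ S') :
    (superpositionComponent A B p ∩ (S ∪ S')).ncard = 2 := by
  classical
  have htree := ncard_superpositionComponent_le A B p
  set K := superpositionComponent A B p
  have hKA := hA.ncard_diff_eq_two_mul (K := K)
    fun e he v hv hvK => mem_sym2_superpositionComponent_left he hv hvK
  have hKB := hB.ncard_diff_eq_two_mul (K := K)
    fun e he v hv hvK => mem_sym2_superpositionComponent_right he hv hvK
  have hKS : (K ∩ S).ncard + (K \ S).ncard = K.ncard := Set.ncard_inter_add_ncard_sdiff_eq_ncard _ _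
  have hKS' : (K ∩ S').ncard + (K \ S').ncard = K.ncard :=
    Set.ncard_inter_add_ncard_sdiff_eq_ncard _ _
  have hunion : (K ∩ (S ∪ S')).ncard = (K ∩ S).ncard + (K ∩ S').ncard := by
    rw [Set.inter_union_distrib_left]
    exact Set.ncard_union_eq (hS.mono Set.inter_subset_right Set.inter_subset_right)
  have hpos : 0 < (K ∩ (S ∪ S')).ncard :=
    (Set.ncard_pos).2 ⟨p, mem_superpositionComponent.2 .rfl, hp⟩
  omega

end Superposition

section Exchange

variable {V : Type*} {G : SimpleGraph V} {S S' K : Set V} {A B : Finset (Sym2 V)}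

open Classical in
/-- The set of edges obtained from `A` by replacing its edges inside `K` by those of `B`. -/
noncomputable def exchangeOn (K : Set V) (A B : Finset (Sym2 V)) : Finset (Sym2 V) :=
  {e ∈ A | e ∉ K.sym2} ∪ {e ∈ B | e ∈ K.sym2}

theorem mem_exchangeOn {e : Sym2 V} :
    e ∈ exchangeOn K A B ↔ e ∈ A ∧ e ∉ K.sym2 ∨ e ∈ B ∧ e ∈ K.sym2 := by
  simp [exchangeOn]

theorem exchangeOn_exchangeOn (K : Set V) (A B : Finset (Sym2 V)) :
    exchangeOn K (exchangeOn K A B) (exchangeOn K B A) = A := by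
  ext e
  simp only [mem_exchangeOn]
  tauto

theorem prod_exchangeOn_mul_prod_exchangeOn {R : Type*} [CommMonoid R] (K : Set V)
    (A B : Finset (Sym2 V)) (w : Sym2 V → R) :
    (∏ e ∈ exchangeOn K A B, w e) * ∏ e ∈ exchangeOn K B A, w e =
      (∏ e ∈ A, w e) * ∏ e ∈ B, w e := by
  classical
  have hdisj (A B : Finset (Sym2 V)) :
      Disjoint ({e ∈ A | e ∉ K.sym2} : Finset (Sym2 V)) {e ∈ B | e ∈ K.sym2} :=
    Finset.disjoint_left.2 fun e he he' => (Finset.mem_filter.1 he).2 (Finset.mem_filter.1 he').2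
  rw [exchangeOn, exchangeOn, Finset.prod_union (hdisj A B), Finset.prod_union (hdisj B A),
    ← Finset.prod_filter_mul_prod_filter_not A (· ∈ K.sym2),
    ← Finset.prod_filter_mul_prod_filter_not B (· ∈ K.sym2)]
  ac_rfl

theorem superposition_exchangeOn (K : Set V) (A B : Finset (Sym2 V)) :
    superposition (exchangeOn K A B) (exchangeOn K B A) = superposition A B := by
  rw [superposition, superposition]
  congr 1
  ext e
  simp only [Set.mem_union, Finset.mem_coe, mem_exchangeOn]
  tauto

theorem isMatchingOff_exchangeOn (hA : IsMatchingOff G S A) (hB : IsMatchingOff G S' B)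
    (hKA : ∀ e ∈ A, ∀ v ∈ e, v ∈ K → e ∈ K.sym2) (hKB : ∀ e ∈ B, ∀ v ∈ e, v ∈ K → e ∈ K.sym2) :
    IsMatchingOff G (S \ K ∪ S' ∩ K) (exchangeOn K A B) := by
  have hinside {e : Sym2 V} {v : V} (hv : v ∈ e) (hvK : v ∈ K) :
      e ∈ exchangeOn K A B ↔ e ∈ B := by
    grind [mem_exchangeOn]
  have houtside {e : Sym2 V} {v : V} (hv : v ∈ e) (hvK : v ∉ K) :
      e ∈ exchangeOn K A B ↔ e ∈ A := by
    have he : e ∉ K.sym2 := fun he => hvK (Set.mem_sym2_iff_subset.1 he hv)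
    grind [mem_exchangeOn]
  refine ⟨fun e he => ?_, fun e he e' he' v hv hv' => ?_, fun v => ?_⟩
  · rcases mem_exchangeOn.1 he with he | he
    · exact hA.subset_edgeSet he.1
    · exact hB.subset_edgeSet he.1
  · by_cases hvK : v ∈ K
    · exact hB.eq_of_mem_of_mem e ((hinside hv hvK).1 he) e' ((hinside hv' hvK).1 he') v hv hv'
    · exact hA.eq_of_mem_of_mem e ((houtside hv hvK).1 he) e' ((houtside hv' hvK).1 he') v hv hv'
  · by_cases hvK : v ∈ K
    · have hBv := hB.exists_mem_iff v
      grind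
    · have hAv := hA.exists_mem_iff v
      grind

/-- The exchange of the two matchings along the component of `p` in their superposition. -/
noncomputable def exchangeComponent (p : V) (x : Finset (Sym2 V) × Finset (Sym2 V)) :
    Finset (Sym2 V) × Finset (Sym2 V) :=
  (exchangeOn (superpositionComponent x.1 x.2 p) x.1 x.2,
    exchangeOn (superpositionComponent x.1 x.2 p) x.2 x.1)

theorem superpositionComponent_exchangeComponent (p : V)
    (x : Finset (Sym2 V) × Finset (Sym2 V)) :
    superpositionComponent (exchangeComponent p x).1 (exchangeComponent p x).2 p =
      superpositionComponent x.1 x.2 p := by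
  rw [superpositionComponent, exchangeComponent, superposition_exchangeOn, superpositionComponent]

theorem exchangeComponent_exchangeComponent (p : V) (x : Finset (Sym2 V) × Finset (Sym2 V)) :
    exchangeComponent p (exchangeComponent p x) = x := by
  rw [exchangeComponent, superpositionComponent_exchangeComponent]
  exact Prod.ext (exchangeOn_exchangeOn _ _ _) (exchangeOn_exchangeOn _ _ _)

end Exchange

section Condensation

variable {V R : Type*} [Finite V] {G : SimpleGraph V} {S S' E : Set V} {p q r s : V}

open Classical in
/-- The pairs of a matching of `G - S` and a matching of `G - S'` in whose superposition the
component of `p` meets `S ∪ S'` exactly in `E`. -/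
noncomputable def superpositions (G : SimpleGraph V) (S S' : Set V) (p : V) (E : Set V) :
    Finset (Finset (Sym2 V) × Finset (Sym2 V)) :=
  {x ∈ matchings G S ×ˢ matchings G S' | superpositionComponent x.1 x.2 p ∩ (S ∪ S') = E}

theorem mem_superpositions {x : Finset (Sym2 V) × Finset (Sym2 V)} :
    x ∈ superpositions G S S' p E ↔ (IsMatchingOff G S x.1 ∧ IsMatchingOff G S' x.2) ∧
      superpositionComponent x.1 x.2 p ∩ (S ∪ S') = E := by
  simp [superpositions]

theorem exchangeComponent_mem_superpositions (hS : Disjoint S S')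
    {x : Finset (Sym2 V) × Finset (Sym2 V)} (hx : x ∈ superpositions G S S' p E) :
    exchangeComponent p x ∈ superpositions G (symmDiff S E) (symmDiff S' E) p E := by
  obtain ⟨⟨hA, hB⟩, rfl⟩ := mem_superpositions.1 hx
  set K := superpositionComponent x.1 x.2 p with hK
  have hKA : ∀ e ∈ x.1, ∀ v ∈ e, v ∈ K → e ∈ K.sym2 := fun _ he _ =>
    mem_sym2_superpositionComponent_left he
  have hKB : ∀ e ∈ x.2, ∀ v ∈ e, v ∈ K → e ∈ K.sym2 := fun _ he _ =>
    mem_sym2_superpositionComponent_right he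
  have hsymm {S S' : Set V} (hS : Disjoint S S') :
      S \ K ∪ S' ∩ K = symmDiff S (K ∩ (S ∪ S')) := by
    rw [Set.disjoint_left] at hS
    grind
  have hSK := hsymm hS
  have hSK' : S' \ K ∪ S ∩ K = symmDiff S' (K ∩ (S ∪ S')) := Set.union_comm S S' ▸ hsymm hS.symm
  refine mem_superpositions.2 ⟨⟨hSK ▸ isMatchingOff_exchangeOn hA hB hKA hKB,
    hSK' ▸ isMatchingOff_exchangeOn hB hA hKB hKA⟩, ?_⟩
  rw [superpositionComponent_exchangeComponent, ← hK, ← hSK, ← hSK']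
  ext v
  simp only [Set.mem_union, Set.mem_inter_iff, Set.mem_sdiff]
  tauto

/-- The sum of the products of the weights of the pairs in `superpositions G S S' p E`. -/
noncomputable def superpositionSum [CommRing R] (G : SimpleGraph V) (w : Sym2 V → R)
    (S S' : Set V) (p : V) (E : Set V) : R :=
  ∑ x ∈ superpositions G S S' p E, (∏ e ∈ x.1, w e) * ∏ e ∈ x.2, w e

theorem superpositionSum_symmDiff [CommRing R] (w : Sym2 V → R) (hS : Disjoint S S')
    (hE : E ⊆ S ∪ S') :
    superpositionSum G w S S' p E =
      superpositionSum G w (symmDiff S E) (symmDiff S' E) p E := by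
  have hSE : Disjoint (symmDiff S E) (symmDiff S' E) := by
    rw [Set.disjoint_left] at hS ⊢
    grind
  refine Finset.sum_nbij' (exchangeComponent p) (exchangeComponent p)
    (fun x hx => exchangeComponent_mem_superpositions hS hx) (fun x hx => ?_)
    (fun x _ => exchangeComponent_exchangeComponent p x)
    (fun x _ => exchangeComponent_exchangeComponent p x)
    (fun x _ => (prod_exchangeOn_mul_prod_exchangeOn _ _ _ w).symm)
  simpa only [symmDiff_symmDiff_cancel_right] using exchangeComponent_mem_superpositions hSE hx

theorem exists_superpositionComponent_inter_eq_pair {A B : Finset (Sym2 V)}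
    (hA : IsMatchingOff G S A) (hB : IsMatchingOff G S' B) (hS : Disjoint S S')
    (hp : p ∈ S ∪ S') :
    ∃ x ≠ p, superpositionComponent A B p ∩ (S ∪ S') = {p, x} := by
  have hmem : p ∈ superpositionComponent A B p ∩ (S ∪ S') :=
    ⟨mem_superpositionComponent.2 .rfl, hp⟩
  obtain ⟨x, y, hxy, h⟩ :=
    Set.ncard_eq_two.1 (ncard_superpositionComponent_inter hA hB hS hp)
  rw [h] at hmem ⊢
  rcases hmem with rfl | rfl
  · exact ⟨y, hxy.symm, rfl⟩
  · exact ⟨x, hxy, Set.pair_comm _ _⟩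

theorem superpositionComponent_inter_eq_or_eq {A B : Finset (Sym2 V)} (hA : IsMatchingOff G S A)
    (hB : IsMatchingOff G S' B) (hS : Disjoint S S') (hT : S ∪ S' = {p, q, r, s})
    (hG : IsCrossless G p q r s) (hpq : p ≠ q) (hqr : q ≠ r) :
    superpositionComponent A B p ∩ (S ∪ S') = {p, q} ∨
      superpositionComponent A B p ∩ (S ∪ S') = {p, s} := by
  have hp : p ∈ S ∪ S' := by simp [hT]
  have hq : q ∈ S ∪ S' := by simp [hT]
  obtain ⟨x, hxp, hx⟩ := exists_superpositionComponent_inter_eq_pair hA hB hS hp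
  obtain ⟨y, hyq, hy⟩ := exists_superpositionComponent_inter_eq_pair hA hB hS hq
  have hpx : x ∈ superpositionComponent A B p ∩ (S ∪ S') := by simp [hx]
  have hqy : y ∈ superpositionComponent A B q ∩ (S ∪ S') := by simp [hy]
  simp only [hT, Set.mem_inter_iff, mem_superpositionComponent, Set.mem_insert_iff,
    Set.mem_singleton_iff] at hpx hqy
  obtain ⟨hpx, rfl | rfl | rfl | rfl⟩ := hpx
  · exact absurd rfl hxp
  · exact Or.inl hx
  · have hreach : (superposition A B).Reachable p q := by
      obtain ⟨hqy, rfl | rfl | rfl | rfl⟩ := hqy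
      · exact hqy.symm
      · exact absurd rfl hyq
      · exact hpx.trans hqy.symm
      · exact hG _ (superposition_le hA hB) hpx hqy
    have hqx : q ∈ superpositionComponent A B p ∩ (S ∪ S') :=
      ⟨mem_superpositionComponent.2 hreach, hq⟩
    rw [hx] at hqx
    rcases hqx with rfl | rfl
    exacts [absurd rfl hpq, absurd rfl hqr]
  · exact Or.inr hx

theorem matchingSumDelete_mul_matchingSumDelete [CommRing R] (w : Sym2 V → R)
    (hS : Disjoint S S') (hT : S ∪ S' = {p, q, r, s}) (hG : IsCrossless G p q r s)
    (hpq : p ≠ q) (hqr : q ≠ r) (hqs : q ≠ s) :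
    matchingSumDelete G w S * matchingSumDelete G w S' =
      superpositionSum G w S S' p {p, q} + superpositionSum G w S S' p {p, s} := by
  classical
  have hdisj : Disjoint (superpositions G S S' p {p, q}) (superpositions G S S' p {p, s}) := by
    refine Finset.disjoint_left.2 fun x hx hx' => hqs ?_
    have hpair : ({p, q} : Set V) = {p, s} :=
      (mem_superpositions.1 hx).2.symm.trans (mem_superpositions.1 hx').2
    grind
  have hunion : matchings G S ×ˢ matchings G S' =
      superpositions G S S' p {p, q} ∪ superpositions G S S' p {p, s} := by
    ext x
    simp only [Finset.mem_product, mem_matchings, Finset.mem_union, mem_superpositions,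
      ← and_or_left, iff_self_and]
    exact fun hx => superpositionComponent_inter_eq_or_eq hx.1 hx.2 hS hT hG hpq hqr
  rw [matchingSumDelete_eq_sum, matchingSumDelete_eq_sum, Finset.sum_mul_sum,
    ← Finset.sum_product', hunion, Finset.sum_union hdisj]
  rfl

theorem matchingSumDelete_condensation [CommRing R] (w : Sym2 V → R)
    (hG : IsCrossless G p q r s) (hpq : p ≠ q) (hpr : p ≠ r) (hps : p ≠ s) (hqr : q ≠ r)
    (hqs : q ≠ s) (hrs : r ≠ s) :
    matchingSumDelete G w ∅ * matchingSumDelete G w {p, q, r, s} +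
        matchingSumDelete G w {q, s} * matchingSumDelete G w {p, r} =
      matchingSumDelete G w {p, q} * matchingSumDelete G w {r, s} +
        matchingSumDelete G w {p, s} * matchingSumDelete G w {q, r} := by
  have hd₁ : Disjoint (∅ : Set V) {p, q, r, s} := by simp
  have hd₂ : Disjoint ({q, s} : Set V) {p, r} := by simp; grind
  have hd₃ : Disjoint ({p, q} : Set V) {r, s} := by simp; grind
  have hd₄ : Disjoint ({p, s} : Set V) {q, r} := by simp; grind
  have hu₂ : ({q, s} ∪ {p, r} : Set V) = {p, q, r, s} := by grind
  have hu₃ : ({p, q} ∪ {r, s} : Set V) = {p, q, r, s} := by grind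
  have hu₄ : ({p, s} ∪ {q, r} : Set V) = {p, q, r, s} := by grind
  have hpqrs : symmDiff ({p, q, r, s} : Set V) {p, q} = {r, s} := by grind
  have hpqrs' : symmDiff ({p, q, r, s} : Set V) {p, s} = {q, r} := by grind
  have hqs_pq : symmDiff ({q, s} : Set V) {p, q} = {p, s} := by grind
  have hqs_ps : symmDiff ({q, s} : Set V) {p, s} = {p, q} := by grind
  have hpr_pq : symmDiff ({p, r} : Set V) {p, q} = {q, r} := by grind
  have hpr_ps : symmDiff ({p, r} : Set V) {p, s} = {r, s} := by grind
  have hsplit {S S' : Set V} (hS : Disjoint S S') (hT : S ∪ S' = {p, q, r, s}) :=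
    matchingSumDelete_mul_matchingSumDelete w hS hT hG hpq hqr hqs
  have hexchange {S S' : Set V} (hS : Disjoint S S') (hT : S ∪ S' = {p, q, r, s}) :
      matchingSumDelete G w S * matchingSumDelete G w S' =
        superpositionSum G w (symmDiff S {p, q}) (symmDiff S' {p, q}) p {p, q} +
          superpositionSum G w (symmDiff S {p, s}) (symmDiff S' {p, s}) p {p, s} := by
    rw [hsplit hS hT, superpositionSum_symmDiff w hS, superpositionSum_symmDiff w hS] <;>
      simp [hT, Set.insert_subset_iff]
  rw [hexchange hd₁ (Set.empty_union _), hexchange hd₂ hu₂, hsplit hd₃ hu₃, hsplit hd₄ hu₄,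
    hpqrs, hpqrs', hqs_pq, hqs_ps, hpr_pq, hpr_ps, ← Set.bot_eq_empty, bot_symmDiff, bot_symmDiff]
  ring

end Condensation

section DeleteEdges

variable {V R : Type*} {G : SimpleGraph V} {S : Set V} {A : Finset (Sym2 V)} {a b : V}

theorem isMatchingOff_deleteEdges_iff {e : Sym2 V} :
    IsMatchingOff (G.deleteEdges {e}) S A ↔ IsMatchingOff G S A ∧ e ∉ A := by
  have hsub : (A : Set (Sym2 V)) ⊆ (G.deleteEdges {e}).edgeSet ↔
      (A : Set (Sym2 V)) ⊆ G.edgeSet ∧ e ∉ A := by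
    rw [SimpleGraph.edgeSet_deleteEdges, Set.subset_sdiff, Set.disjoint_singleton_right,
      Finset.mem_coe]
  exact ⟨fun h => ⟨⟨(hsub.1 h.1).1, h.2, h.3⟩, (hsub.1 h.1).2⟩,
    fun h => ⟨hsub.2 ⟨h.1.1, h.2⟩, h.1.2, h.1.3⟩⟩

theorem isMatchingOff_insert_iff [DecidableEq V] (hab : G.Adj a b) (he : s(a, b) ∉ A) :
    IsMatchingOff G S (insert s(a, b) A) ↔
      IsMatchingOff G (S ∪ {a, b}) A ∧ a ∉ S ∧ b ∉ S := by
  constructor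
  · intro h
    have hS {v : V} (hv : v ∈ s(a, b)) : v ∉ S := h.notMem (Finset.mem_insert_self _ _) hv
    have hnot {e : Sym2 V} (heA : e ∈ A) {v : V} (hv : v ∈ e) : v ∉ s(a, b) := fun hv' =>
      he (h.eq_of_mem_of_mem e (by simp [heA]) s(a, b) (by simp) v hv hv' ▸ heA)
    refine ⟨⟨fun e heA => h.subset_edgeSet (by simp [heA]), fun e heA e' heA' =>
      h.eq_of_mem_of_mem e (by simp [heA]) e' (by simp [heA']), fun v => ?_⟩,
      hS (Sym2.mem_mk_left a b), hS (Sym2.mem_mk_right a b)⟩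
    have hv := h.exists_mem_iff v
    grind
  · rintro ⟨h, ha, hb⟩
    have hnot {e : Sym2 V} (heA : e ∈ A) {v : V} (hv : v ∈ e) : v ∉ s(a, b) := by
      have hvS := h.notMem heA hv
      grind
    refine ⟨?_, ?_, fun v => ?_⟩
    · simpa [Set.insert_subset_iff] using ⟨hab, h.subset_edgeSet⟩
    · have hA := h.eq_of_mem_of_mem
      grind
    · have hv := h.exists_mem_iff v
      grind

variable [Finite V] [CommRing R]

theorem matchingSumDelete_deleteEdges_of_mem (w : Sym2 V → R) {v : V} {e : Sym2 V} (hv : v ∈ S)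
    (he : v ∈ e) : matchingSumDelete (G.deleteEdges {e}) w S = matchingSumDelete G w S := by
  rw [matchingSumDelete_eq_sum, matchingSumDelete_eq_sum]
  congr 1
  ext A
  rw [mem_matchings, mem_matchings, isMatchingOff_deleteEdges_iff, and_iff_left_iff_imp]
  exact fun hA heA => hA.notMem heA he hv

theorem matchingSumDelete_eq_add (w : Sym2 V → R) (hab : G.Adj a b) (ha : a ∉ S) (hb : b ∉ S) :
    matchingSumDelete G w S = matchingSumDelete (G.deleteEdges {s(a, b)}) w S +
      w s(a, b) * matchingSumDelete (G.deleteEdges {s(a, b)}) w (S ∪ {a, b}) := by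
  classical
  rw [matchingSumDelete_deleteEdges_of_mem w (v := a) (S := S ∪ {a, b}) (by simp) (by simp)]
  simp only [matchingSumDelete_eq_sum]
  have hsplit := Finset.sum_filter_not_add_sum_filter (matchings G S) (s(a, b) ∈ ·)
    fun A => ∏ e ∈ A, w e
  rw [← hsplit]
  congr 1
  · congr 1
    ext A
    simp [isMatchingOff_deleteEdges_iff]
  · have hnot {A : Finset (Sym2 V)} (hA : A ∈ matchings G (S ∪ {a, b})) : s(a, b) ∉ A :=
      fun he => (mem_matchings.1 hA).notMem he (Sym2.mem_mk_left a b) (by simp)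
    rw [Finset.mul_sum]
    refine Finset.sum_nbij' (Finset.erase · s(a, b)) (insert s(a, b)) ?_ ?_ ?_ ?_ ?_
    · intro A hA
      obtain ⟨hA, he⟩ := Finset.mem_filter.1 hA
      rw [mem_matchings] at hA ⊢
      rw [← Finset.insert_erase he] at hA
      exact ((isMatchingOff_insert_iff hab (Finset.notMem_erase _ _)).1 hA).1
    · intro A hA
      have he := hnot hA
      rw [mem_matchings] at hA
      simpa using (isMatchingOff_insert_iff hab he).2 ⟨hA, ha, hb⟩
    · intro A hA
      exact Finset.insert_erase (Finset.mem_filter.1 hA).2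
    · intro A hA
      exact Finset.erase_insert (hnot hA)
    · intro A hA
      exact (Finset.mul_prod_erase A w (Finset.mem_filter.1 hA).2).symm

end DeleteEdges

section Coloring

variable {V R : Type*} [Finite V] {G : SimpleGraph V} {S : Set V} {A : Finset (Sym2 V)}

theorem IsMatchingOff.ncard_color_diff (C : G.Coloring (Fin 2)) (hA : IsMatchingOff G S A)
    (c : Fin 2) : ({v | C v = c} \ S).ncard = A.card := by
  have hone : ∀ e ∈ A, {v ∈ {v | C v = c} | v ∈ e}.ncard = 1 := by
    intro e he
    rw [Set.ncard_eq_one]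
    induction e with | _ u v =>
    have huv : C u ≠ C v := C.valid (hA.subset_edgeSet he)
    by_cases hu : C u = c
    · exact ⟨u, by ext x; simp; grind⟩
    · exact ⟨v, by ext x; simp; grind⟩
  rw [hA.ncard_diff, Finset.sum_congr rfl hone, Finset.sum_const, smul_eq_mul, mul_one]

theorem IsMatchingOff.ncard_color_eq_add_two (C : G.Coloring (Fin 2)) {x x' : V}
    (hA : IsMatchingOff G {x, x'} A) (hx : x ≠ x') (hxx : C x = C x') {c : Fin 2} (hc : C x ≠ c) :
    {v | C v = C x}.ncard = {v | C v = c}.ncard + 2 := by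
  have hsub : {x, x'} ⊆ {v | C v = C x} := by simp [Set.insert_subset_iff, hxx]
  have hdisj : Disjoint {v | C v = c} {x, x'} := by simp [← hxx, hc]
  rw [← Set.ncard_sdiff_add_ncard_of_subset hsub, Set.ncard_pair hx, hA.ncard_color_diff,
    ← hdisj.sdiff_eq_left, hA.ncard_color_diff]

theorem matchingSumDelete_mul_eq_zero [CommRing R] (C : G.Coloring (Fin 2)) (w : Sym2 V → R)
    {x x' y y' : V} (hx : x ≠ x') (hy : y ≠ y') (hxx : C x = C x') (hyy : C y = C y')
    (hxy : C x ≠ C y) :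
    matchingSumDelete G w {x, x'} * matchingSumDelete G w {y, y'} = 0 := by
  simp only [matchingSumDelete_eq_sum]
  rw [Finset.sum_mul_sum]
  refine Finset.sum_eq_zero fun A hA => Finset.sum_eq_zero fun B hB => ?_
  rw [mem_matchings] at hA hB
  have hxy' := hA.ncard_color_eq_add_two C hx hxx hxy
  have hyx' := hB.ncard_color_eq_add_two C hy hyy hxy.symm
  omega

end Coloring

section CrosslessIdentity

variable {V R : Type*} [Finite V] [CommRing R] {G : SimpleGraph V} {a b a₁ b₁ a₂ b₂ : V}

theorem matchingSum_eq_matchingSumDelete_empty (G : SimpleGraph V) (w : Sym2 V → R) :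
    matchingSum G w = matchingSumDelete G w ∅ := by
  rw [matchingSum_eq_sum, matchingSumDelete_eq_sum]

theorem matchingSum_eq_add (w : Sym2 V → R) (hab : G.Adj a b) :
    matchingSum G w = matchingSum (G.deleteEdges {s(a, b)}) w +
      w s(a, b) * matchingSumDelete (G.deleteEdges {s(a, b)}) w {a, b} := by
  rw [matchingSum_eq_matchingSumDelete_empty, matchingSum_eq_matchingSumDelete_empty,
    matchingSumDelete_eq_add w hab (Set.notMem_empty a) (Set.notMem_empty b), Set.empty_union]

theorem matchingSum_mul_matchingSum_deleteEdges (w : Sym2 V → R)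
    (h₁ : G.Adj a₁ b₁) (h₂ : G.Adj a₂ b₂) (ha : a₁ ≠ a₂) (hab : a₁ ≠ b₂) (hba : b₁ ≠ a₂)
    (hb : b₁ ≠ b₂) (hG : IsCrossless G a₁ b₁ a₂ b₂) :
    matchingSum G w * matchingSum (G.deleteEdges {s(a₁, b₁), s(a₂, b₂)}) w =
      matchingSum (G.deleteEdges {s(a₁, b₁)}) w * matchingSum (G.deleteEdges {s(a₂, b₂)}) w +
        w s(a₁, b₁) * w s(a₂, b₂) *
          (matchingSumDelete G w {a₁, b₂} * matchingSumDelete G w {a₂, b₁} -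
            matchingSumDelete G w {a₁, a₂} * matchingSumDelete G w {b₁, b₂}) := by
  let G₁ := G.deleteEdges {s(a₁, b₁)}
  let G₂ := G.deleteEdges {s(a₂, b₂)}
  let H := G.deleteEdges {s(a₁, b₁), s(a₂, b₂)}
  have hH₁ : G₁.deleteEdges {s(a₂, b₂)} = H := by
    rw [SimpleGraph.deleteEdges_deleteEdges, Set.singleton_union]
  have hH₂ : G₂.deleteEdges {s(a₁, b₁)} = H := by
    rw [SimpleGraph.deleteEdges_deleteEdges, Set.union_singleton]
  have hadj₁ : G₁.Adj a₂ b₂ := by simp only [G₁, SimpleGraph.deleteEdges_adj]; grind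
  have hadj₂ : G₂.Adj a₁ b₁ := by simp only [G₂, SimpleGraph.deleteEdges_adj]; grind
  have hdelete {u v : V} (hu : u ∈ s(a₁, b₁)) (hv : v ∈ s(a₂, b₂)) :
      matchingSumDelete G w {u, v} = matchingSumDelete H w {u, v} := by
    rw [← hH₁, matchingSumDelete_deleteEdges_of_mem w (v := v) (by simp) hv,
      matchingSumDelete_deleteEdges_of_mem w (v := u) (by simp) hu]
  have hM₁ : matchingSum G₁ w =
      matchingSum H w + w s(a₂, b₂) * matchingSumDelete H w {a₂, b₂} :=
    hH₁ ▸ matchingSum_eq_add w hadj₁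
  have hM₂ : matchingSum G₂ w =
      matchingSum H w + w s(a₁, b₁) * matchingSumDelete H w {a₁, b₁} :=
    hH₂ ▸ matchingSum_eq_add w hadj₂
  have hM : matchingSum G w =
      matchingSum G₁ w + w s(a₁, b₁) * matchingSumDelete G₁ w {a₁, b₁} := matchingSum_eq_add w h₁
  have hM₁₂ : matchingSumDelete G₁ w {a₁, b₁} = matchingSumDelete H w {a₁, b₁} +
      w s(a₂, b₂) * matchingSumDelete H w {a₁, b₁, a₂, b₂} := by
    rw [matchingSumDelete_eq_add w hadj₁ (by grind) (by grind), hH₁, Set.insert_union,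
      Set.singleton_union]
  have hH : IsCrossless H a₁ b₁ a₂ b₂ := hG.mono (G.deleteEdges_le _)
  have hcond := matchingSumDelete_condensation w hH h₁.ne ha hab hba hb h₂.ne
  rw [← matchingSum_eq_matchingSumDelete_empty] at hcond
  rw [hM, hM₁₂, hM₁, hM₂, Set.pair_comm a₂ b₁, hdelete (by simp) (by simp),
    hdelete (by simp) (by simp), hdelete (by simp) (by simp), hdelete (by simp) (by simp)]
  linear_combination w s(a₁, b₁) * w s(a₂, b₂) * hcond

end CrosslessIdentity

theorem corollary3p5_general {V R : Type*} [Finite V] [CommRing R]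
    (G : SimpleGraph V) (C : G.Coloring (Fin 2)) (w : Sym2 V → R)
    (a₁ b₁ a₂ b₂ : V) (h₁ : G.Adj a₁ b₁) (h₂ : G.Adj a₂ b₂)
    (ha : a₁ ≠ a₂) (hab : a₁ ≠ b₂) (hba : b₁ ≠ a₂) (hb : b₁ ≠ b₂)
    (hG : IsCrossless G a₁ b₁ a₂ b₂) :
    (C a₁ = C a₂ →
      matchingSum G w * matchingSum (G.deleteEdges {s(a₁, b₁), s(a₂, b₂)}) w =
        matchingSum (G.deleteEdges {s(a₁, b₁)}) w * matchingSum (G.deleteEdges {s(a₂, b₂)}) w +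
        w s(a₁, b₁) * w s(a₂, b₂) *
          (matchingSumDelete G w {a₁, b₂} * matchingSumDelete G w {a₂, b₁})) ∧
    (C a₁ ≠ C a₂ →
      matchingSum G w * matchingSum (G.deleteEdges {s(a₁, b₁), s(a₂, b₂)}) w =
        matchingSum (G.deleteEdges {s(a₁, b₁)}) w * matchingSum (G.deleteEdges {s(a₂, b₂)}) w -
        w s(a₁, b₁) * w s(a₂, b₂) *
          (matchingSumDelete G w {a₁, a₂} * matchingSumDelete G w {b₁, b₂})) := by
  have hC₁ : C a₁ ≠ C b₁ := C.valid h₁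
  have hC₂ : C a₂ ≠ C b₂ := C.valid h₂
  rw [matchingSum_mul_matchingSum_deleteEdges w h₁ h₂ ha hab hba hb hG]
  refine ⟨fun hC => ?_, fun hC => ?_⟩
  · rw [matchingSumDelete_mul_eq_zero C w ha hb hC (by omega) hC₁, sub_zero]
  · rw [matchingSumDelete_mul_eq_zero C w hab hba.symm (by omega) (by omega) hC, zero_sub,
      mul_neg, sub_eq_add_neg]

theorem corollary3p5 {V R : Type*} [Finite V] [CommRing R]
    (G : SimpleGraph V) (D : PlaneDrawing G) (C : G.Coloring (Fin 2)) (w : Sym2 V → R)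
    (a₁ b₁ a₂ b₂ : V) (h₁ : G.Adj a₁ b₁) (h₂ : G.Adj a₂ b₂)
    (ha : a₁ ≠ a₂) (hab : a₁ ≠ b₂) (hba : b₁ ≠ a₂) (hb : b₁ ≠ b₂)
    (F : Set ℂ) (hF : D.IsFace F)
    (he₁ : D.EdgeOnBoundary F s(a₁, b₁)) (he₂ : D.EdgeOnBoundary F s(a₂, b₂))
    (F' : Set ℂ) (hcyc : D.CyclicOrderOnFace F' a₁ b₁ a₂ b₂) :
    (C a₁ = C a₂ →
      matchingSum G w * matchingSum (G.deleteEdges {s(a₁, b₁), s(a₂, b₂)}) w =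
        matchingSum (G.deleteEdges {s(a₁, b₁)}) w * matchingSum (G.deleteEdges {s(a₂, b₂)}) w +
        w s(a₁, b₁) * w s(a₂, b₂) *
          (matchingSumDelete G w {a₁, b₂} * matchingSumDelete G w {a₂, b₁})) ∧
    (C a₁ ≠ C a₂ →
      matchingSum G w * matchingSum (G.deleteEdges {s(a₁, b₁), s(a₂, b₂)}) w =
        matchingSum (G.deleteEdges {s(a₁, b₁)}) w * matchingSum (G.deleteEdges {s(a₂, b₂)}) w -
        w s(a₁, b₁) * w s(a₂, b₂) *
          (matchingSumDelete G w {a₁, a₂} * matchingSumDelete G w {b₁, b₂})) :=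
  corollary3p5_general G C w a₁ b₁ a₂ b₂ h₁ h₂ ha hab hba hb hcyc.isCrossless
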